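/- Let $PSL(2,\mathbb{R}) = SL(2,\mathbb{R})/\{\pm \mathrm{Id}\}$ and let $U \subset PSL(2,\mathbb{R})$ be the image of the group of unipotent matrices $\begin{pmatrix} 1 & t \\ 0 & 1\end{pmatrix}$, $t \in \mathbb{R}$. Let $G$ be a connected (finite-dimensional, real) Lie group, let $\Gamma$ be a discrete subgroup of $PSL(2,\mathbb{R}) \times G$ such that the left quotient $X = \Gamma \backslash (PSL(2,\mathbb{R}) \times G)$ is compact, and let $p_2 : PSL(2,\mathbb{R}) \times G \to G$ be the second projection. Any subgroup $F$ of $PSL(2,\mathbb{R})$ acts on $X$ on the right by $\Gamma(f,g)\cdot f' = \Gamma(ff',g)$; the action is called minimal if all its orbits are dense in $X$. Then the right $U$-action on $X$ (the horocycle flow) is minimal if and only if the right $PSL(2,\mathbb{R})$-action on $X$ is minimal, and the latter holds if and only if $p_2(\Gamma)$ is dense in $G$. In particular, if $G$ is trivial, then the right $U$-action on $X$ is minimal (Hedlund's theorem). -/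

import Mathlib

open scoped MatrixGroups Manifold ContDiff

namespace Horocycle

/-- The subgroup of `SL(2, ℝ)` of the upper triangular unipotent matrices `(1 t; 0 1)`, `t ∈ ℝ`. -/
def unipotentSL : Subgroup SL(2, ℝ) where
  carrier := {A | ∃ t : ℝ, (A : Matrix (Fin 2) (Fin 2) ℝ) = !![1, t; 0, 1]}
  one_mem' := ⟨0, by simp [Matrix.one_fin_two]⟩
  mul_mem' := by
    rintro A B ⟨s, hs⟩ ⟨t, ht⟩
    exact ⟨t + s, by simp [hs, ht]⟩
  inv_mem' := by
    rintro A ⟨s, hs⟩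
    exact ⟨-s, by rw [Matrix.SpecialLinearGroup.coe_inv, hs, Matrix.adjugate_fin_two_of]; simp⟩

/-- The unipotent subgroup `U` of `PSL(2, ℝ) = SL(2, ℝ) / {± Id}`: the image of the group of
matrices `(1 t; 0 1)`, `t ∈ ℝ`. -/
def U : Subgroup PSL(2, ℝ) := unipotentSL.map (QuotientGroup.mk' _)

variable {G : Type*} [Group G]

/-- The left quotient `X = Γ \ (PSL(2, ℝ) × G)`, the set of classes `Γ h`. -/
def X (Γ : Subgroup (PSL(2, ℝ) × G)) : Type _ := Quotient (QuotientGroup.rightRel Γ)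

/-- The class `Γ h` of `h`. -/
def X.mk (Γ : Subgroup (PSL(2, ℝ) × G)) (h : PSL(2, ℝ) × G) : X Γ :=
  Quotient.mk (QuotientGroup.rightRel Γ) h

/-- `X` carries the quotient topology. -/
instance [TopologicalSpace G] (Γ : Subgroup (PSL(2, ℝ) × G)) : TopologicalSpace (X Γ) :=
  inferInstanceAs (TopologicalSpace (Quotient (QuotientGroup.rightRel Γ)))

theorem X.mk_eq_mk {Γ : Subgroup (PSL(2, ℝ) × G)} {h k : PSL(2, ℝ) × G} :
    X.mk Γ h = X.mk Γ k ↔ ∃ γ ∈ Γ, γ * h = k := by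
  refine (Quotient.eq (r := QuotientGroup.rightRel Γ)).trans ?_
  rw [QuotientGroup.rightRel_apply]
  constructor
  · intro hk
    exact ⟨k * h⁻¹, hk, by group⟩
  · rintro ⟨γ, hγ, rfl⟩
    simpa using hγ

/-- The right action of `PSL(2, ℝ)` on `X` (that is, the action of the opposite group), given by
`Γ (f, g) · f' = Γ (f f', g)`. Its restriction to a subgroup `F` is the action of `F.op`. -/
instance (Γ : Subgroup (PSL(2, ℝ) × G)) : MulAction PSL(2, ℝ)ᵐᵒᵖ (X Γ) where
  smul f' := Quotient.lift (fun h : PSL(2, ℝ) × G => X.mk Γ (h.1 * f'.unop, h.2)) (by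
    intro h k hk
    obtain ⟨γ, hγ, rfl⟩ := X.mk_eq_mk.1 (Quotient.sound hk : X.mk Γ h = X.mk Γ k)
    exact X.mk_eq_mk.2 ⟨γ, hγ, by ext <;> simp [mul_assoc]⟩)
  one_smul := by
    rintro ⟨f, g⟩
    change X.mk Γ (f * 1, g) = X.mk Γ (f, g)
    rw [mul_one]
  mul_smul := by
    rintro a b ⟨f, g⟩
    change X.mk Γ (f * (b.unop * a.unop), g) = X.mk Γ (f * b.unop * a.unop, g)
    rw [mul_assoc]

theorem X.op_smul_mk (Γ : Subgroup (PSL(2, ℝ) × G)) (f f' : PSL(2, ℝ)) (g : G) :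
    MulOpposite.op f' • X.mk Γ (f, g) = X.mk Γ (f * f', g) := rfl

end Horocycle

/-! Everything is lifted to `SL(2, ℝ) × G`, where orbit closures become closed sets invariant under
`Γ` on the left and the unipotent flow on the right. Minimality of the `PSL(2, ℝ)`-action is a
matter of the second factor only, and it follows from minimality of the `U`-action because orbits
grow; the substance is that density of `p₂(Γ)` forces every closed invariant set to be everything
(`IsClosedInvariant.eq_univ`).

By Zorn and cocompactness it is enough to treat a minimal set `N`. Its points are recurrent, so
there are `ε → 1` with `g * ε ∈ N`, and these can be taken not upper triangular
(`exists_return_not_upper_triangular`), since `Γ` has no element with nontrivial unipotent first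
component. Shearing such an `ε` by the unipotent flow on both sides produces any diagonal matrix in
the limit, so `N` is invariant under the diagonal flow (`mul_diag_mem_of_minimal`). That flow
preserves Haar measure; Poincaré recurrence (`exists_return`) combined with its contraction of the
lower unipotent direction gives invariance under lower unipotents (`mul_lower_mem`). Hence `N` is
`SL(2, ℝ)`-invariant, and density of `p₂(Γ)` finishes. -/

namespace Horocycle

open Filter Topology MeasureTheory MeasureTheory.Measure

/-! ### Discrete cocompact subgroups of topological groups -/

section TopologicalGroup

variable {H : Type*} [Group H] [TopologicalSpace H]

/-- The nonempty closed sets which are invariant under left multiplication by `Γ` and right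
multiplication by `T`. -/
structure IsClosedInvariant (Γ : Subgroup H) (T M : Set H) : Prop where
  isClosed : IsClosed M
  nonempty : M.Nonempty
  left_mem : ∀ γ ∈ Γ, ∀ m ∈ M, γ * m ∈ M
  right_mem : ∀ m ∈ M, ∀ t ∈ T, m * t ∈ M

variable [T2Space H] {Γ : Subgroup H} {K : Set H}

/-- Zorn: every invariant set meets the compact set `K`, so a chain has nonempty intersection. -/
theorem IsClosedInvariant.exists_minimal {T M : Set H} (hM : IsClosedInvariant Γ T M)
    (hK : IsCompact K) (hΓK : ∀ h, ∃ γ ∈ Γ, γ * h ∈ K) :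
    ∃ N ⊆ M, Minimal (IsClosedInvariant Γ T) N := by
  refine zorn_superset_nonempty {N | IsClosedInvariant Γ T N} ?_ M hM
  intro c hc hchain hne
  refine ⟨⋂₀ c, ⟨isClosed_sInter fun s hs => (hc hs).isClosed, ?_, ?_, ?_⟩,
    fun s hs => Set.sInter_subset_of_mem hs⟩
  · have : Nonempty c := hne.to_subtype
    have hmeet (s : c) : (K ∩ s).Nonempty := by
      obtain ⟨m, hm⟩ := (hc s.2).nonempty
      obtain ⟨γ, hγ, hk⟩ := hΓK m
      exact ⟨γ * m, hk, (hc s.2).left_mem γ hγ m hm⟩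
    have hdir : Directed (· ⊇ ·) fun s : c => K ∩ (s : Set H) := by
      intro s t
      rcases hchain.total s.2 t.2 with h | h
      · exact ⟨s, subset_rfl, Set.inter_subset_inter_right _ h⟩
      · exact ⟨t, Set.inter_subset_inter_right _ h, subset_rfl⟩
    obtain ⟨x, hx⟩ := IsCompact.nonempty_iInter_of_directed_nonempty_isCompact_isClosed _ hdir hmeet
      (fun s => hK.inter_right (hc s.2).isClosed)
      fun s => hK.isClosed.inter (hc s.2).isClosed
    exact ⟨x, fun s hs => (Set.mem_iInter.1 hx ⟨s, hs⟩).2⟩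
  · exact fun γ hγ m hm s hs => (hc hs).left_mem γ hγ m (hm s hs)
  · exact fun m hm t ht s hs => (hc hs).right_mem m (hm s hs) t ht

variable [IsTopologicalGroup H]

theorem eventually_eq_of_tendsto_of_mem_discrete [DiscreteTopology Γ] {ι : Type*} {l : Filter ι}
    {δ : ι → H} {c : H} (hδ : ∀ i, δ i ∈ Γ) (h : Tendsto δ l (𝓝 c)) : ∀ᶠ i in l, δ i = c := by
  rcases l.eq_or_neBot with rfl | _
  · simp
  have hc : c ∈ Γ := (Subgroup.isClosed_of_discrete (H := Γ)).mem_of_tendsto h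
    (Eventually.of_forall hδ)
  have h' : Tendsto (fun i => (⟨δ i, hδ i⟩ : Γ)) l (𝓝 ⟨c, hc⟩) := tendsto_subtype_rng.2 h
  rw [nhds_discrete, tendsto_pure] at h'
  filter_upwards [h'] with i hi using congrArg Subtype.val hi

/-- The conjugacy class of `γ` is closed: translating `x i` into `K` by `δ i ∈ Γ`, the elements `δ i
* γ * (δ i)⁻¹` of `Γ` converge, hence are eventually constant by discreteness. -/
theorem exists_conj_eq_of_tendsto [DiscreteTopology Γ] (hK : IsCompact K)
    (hΓK : ∀ h, ∃ γ ∈ Γ, γ * h ∈ K) {ι : Type*} {l : Filter ι} [l.NeBot] {γ : H} (hγ : γ ∈ Γ)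
    {x : ι → H} {c : H} (h : Tendsto (fun i => (x i)⁻¹ * γ * x i) l (𝓝 c)) :
    ∃ k, c = k⁻¹ * γ * k := by
  choose δ hδ hδK using fun i => hΓK (x i)
  set F := Ultrafilter.of l
  obtain ⟨p, -, hp⟩ := hK.ultrafilter_le_nhds (F.map fun i => δ i * x i)
    (le_principal_iff.2 (Ultrafilter.mem_map.2 (univ_mem' hδK)))
  have hp : Tendsto (fun i => δ i * x i) F (𝓝 p) := hp
  have hc := h.mono_left (Ultrafilter.of_le l)
  have hlim : Tendsto (fun i => δ i * γ * (δ i)⁻¹) F (𝓝 (p * c * p⁻¹)) := by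
    refine ((hp.mul hc).mul hp.inv).congr fun i => ?_
    group
  obtain ⟨i, hi⟩ := (eventually_eq_of_tendsto_of_mem_discrete
    (fun i => Γ.mul_mem (Γ.mul_mem (hδ i) hγ) (Γ.inv_mem (hδ i))) hlim).exists
  refine ⟨(δ i)⁻¹ * p, ?_⟩
  calc c = p⁻¹ * (p * c * p⁻¹) * p := by group
    _ = _ := by rw [← hi]; group

omit [T2Space H] in
theorem haar_preimage_mul_right [LocallyCompactSpace H] [MeasurableSpace H] [BorelSpace H] {a : H}
    (ha : modularCharacter a = 1) {V : Set H} (hVo : IsOpen V) (hV : IsCompact (closure V)) :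
    haar ((· * a) ⁻¹' V) = haar V := by
  have h := measure_isMulInvariant_eq_smul_of_isCompact_closure (map (· * a) haar) haar hV
  rw [← modularCharacterFun_eq_haarScalarFactor,
    map_apply (continuous_mul_const a).measurable hVo.measurableSet] at h
  have ha' : modularCharacterFun a = 1 := ha
  rw [h, ha', one_smul]

omit [T2Space H] in
/-- Right multiplication by an element of modular character `1` is non-wandering modulo a discrete
cocompact subgroup. -/
theorem exists_return [LocallyCompactSpace H] [DiscreteTopology Γ] (hK : IsCompact K)
    (hΓK : ∀ h, ∃ γ ∈ Γ, γ * h ∈ K) {a : H} (ha : modularCharacter a = 1) (y : H) {O : Set H}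
    (hO : O ∈ 𝓝 1) :
    ∃ n ≥ 1, ∃ γ ∈ Γ, ∃ u ∈ O, ∃ v ∈ O, γ * (y * u) * a ^ n = y * v := by
  borelize H
  by_contra! hret
  obtain ⟨D, hD, hDΓ⟩ : ∃ D ∈ 𝓝 (1 : H), ∀ γ ∈ Γ, γ ∈ D → γ = 1 := by
    have h : ({1} : Set Γ) ∈ 𝓝 (1 : Γ) := by simp
    obtain ⟨D, hD, h⟩ := mem_nhds_subtype _ _ _ |>.1 h
    exact ⟨D, hD, fun γ hγ hγD => congrArg Subtype.val (h (a := ⟨γ, hγ⟩) hγD)⟩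
  obtain ⟨W₁, hW₁, hW₁D⟩ : ∃ W ∈ 𝓝 (1 : H), ∀ u ∈ W, ∀ v ∈ W, y * v * u⁻¹ * y⁻¹ ∈ D := by
    have hc : Continuous fun p : H × H => y * p.2 * p.1⁻¹ * y⁻¹ := by fun_prop
    have h : (fun p : H × H => y * p.2 * p.1⁻¹ * y⁻¹) ⁻¹' D ∈ 𝓝 ((1 : H), (1 : H)) :=
      hc.continuousAt.preimage_mem_nhds (by simp [hD])
    rw [nhds_prod_eq, mem_prod_same_iff] at h
    obtain ⟨W, hW, h⟩ := h
    exact ⟨W, hW, fun u hu v hv => h (Set.mk_mem_prod hu hv)⟩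
  obtain ⟨C, hC, hC1⟩ := exists_compact_mem_nhds (1 : H)
  obtain ⟨V, hVsub, hVo, hV1⟩ := mem_nhds_iff.1 (inter_mem hO (inter_mem hW₁ hC1))
  have hVc : IsCompact (closure V) :=
    hC.closure_of_subset fun v hv => (hVsub hv).2.2
  obtain ⟨K', hK', hKK'⟩ := exists_compact_superset hK
  have hfin (n : ℕ) : ∃ F : Finset Γ, ∀ v ∈ V, ∃ γ ∈ F, (γ : H) * (y * v * a ^ n) ∈ interior K' := by
    have hcov : closure V ⊆ ⋃ γ : Γ, (fun v => (γ : H) * (y * v * a ^ n)) ⁻¹' interior K' := by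
      intro v _
      obtain ⟨γ, hγ, h⟩ := hΓK (y * v * a ^ n)
      exact Set.mem_iUnion.2 ⟨⟨γ, hγ⟩, hKK' h⟩
    obtain ⟨F, hF⟩ := hVc.elim_finite_subcover _
      (fun γ => isOpen_interior.preimage (by fun_prop)) hcov
    refine ⟨F, fun v hv => ?_⟩
    simpa using hF (subset_closure hv)
  choose F hF using hfin
  -- `A n = y V aⁿ`. Without returns, `Γ`-translates of different `A n` are disjoint; distinct
  -- translates of one `A n` are disjoint because `V` is small. Each `A n` puts mass at least `haar
  -- V` into `K'`, which has finite measure.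
  set A : ℕ → Set H := fun n => {h | y⁻¹ * h * (a ^ n)⁻¹ ∈ V}
  have hAo (n : ℕ) : IsOpen (A n) := hVo.preimage (by fun_prop)
  have hA (n : ℕ) : haar (A n) = haar V := by
    have h1 : modularCharacter ((a ^ n)⁻¹) = 1 := by
      have h : modularCharacter ((a ^ n)⁻¹) * modularCharacter (a ^ n) = 1 := by
        rw [← map_mul, inv_mul_cancel, map_one]
      rwa [map_pow, ha, one_pow, mul_one] at h
    rw [← haar_preimage_mul_right h1 hVo hVc, ← measure_preimage_mul haar y]
    congr 1
    ext h
    simp [A]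
  set B : (Σ _ : ℕ, Γ) → Set H := fun p => interior K' ∩ {h | (p.2 : H)⁻¹ * h ∈ A p.1}
  have hBo (p) : IsOpen (B p) :=
    isOpen_interior.inter ((hAo p.1).preimage (continuous_const_mul _))
  have hdisj (p q) (hpq : p ≠ q) : Disjoint (B p) (B q) := by
    rw [Set.disjoint_left]
    rintro h ⟨-, hp⟩ ⟨-, hq⟩
    apply hpq
    have hlt (p q : Σ _ : ℕ, Γ) (hp : (p.2 : H)⁻¹ * h ∈ A p.1) (hq : (q.2 : H)⁻¹ * h ∈ A q.1) :
        ¬ p.1 < q.1 := by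
      intro hlt
      refine hret (q.1 - p.1) (by omega) ((p.2 : H)⁻¹ * q.2) (Γ.mul_mem (Γ.inv_mem p.2.2) q.2.2)
        _ (hVsub hq).1 _ (hVsub hp).1 ?_
      obtain ⟨k, hk⟩ := Nat.exists_eq_add_of_lt hlt
      have : q.1 - p.1 = k + 1 := by omega
      rw [this, hk, add_assoc, add_comm p.1, pow_add a (k + 1)]
      group
    obtain ⟨n, γ⟩ := p
    obtain ⟨m, δ⟩ := q
    obtain rfl : n = m := le_antisymm (not_lt.1 (hlt _ _ hq hp)) (not_lt.1 (hlt _ _ hp hq))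
    have hD' := hW₁D _ (hVsub hp).2.1 _ (hVsub hq).2.1
    have h1 := hDΓ ((δ : H)⁻¹ * γ) (Γ.mul_mem (Γ.inv_mem δ.2) γ.2) (by
      convert hD' using 1
      group)
    rw [inv_mul_eq_one] at h1
    rw [Subtype.ext h1]
  have hcover (n : ℕ) : haar V ≤ ∑ γ ∈ F n, haar (B ⟨n, γ⟩) := by
    have hsub : A n ⊆ ⋃ γ ∈ F n, ((γ : H) * ·) ⁻¹' B ⟨n, γ⟩ := by
      intro h hh
      obtain ⟨γ, hγ, hh'⟩ := hF n _ hh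
      refine Set.mem_biUnion hγ ⟨?_, ?_⟩
      · convert hh' using 1
        group
      · simpa using hh
    rw [← hA n]
    refine (measure_mono hsub).trans ((measure_biUnion_finset_le _ _).trans_eq ?_)
    simp_rw [measure_preimage_mul]
  have hbound (N : ℕ) : N * haar V ≤ haar (interior K') := by
    calc N * haar V = ∑ n ∈ Finset.range N, haar V := by simp
      _ ≤ ∑ n ∈ Finset.range N, ∑ γ ∈ F n, haar (B ⟨n, γ⟩) :=
        Finset.sum_le_sum fun n _ => hcover n
      _ = ∑ p ∈ (Finset.range N).sigma F, haar (B p) := Finset.sum_sigma' _ _ _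
      _ = haar (⋃ p ∈ (Finset.range N).sigma F, B p) :=
        (measure_biUnion_finset (fun p _ q _ => hdisj p q) fun p _ => (hBo p).measurableSet).symm
      _ ≤ haar (interior K') := measure_mono (Set.iUnion₂_subset fun p _ => Set.inter_subset_left)
  have hpos : haar V ≠ 0 := (hVo.measure_pos haar ⟨1, hV1⟩).ne'
  have hlt : haar (interior K') < ⊤ := (measure_mono interior_subset).trans_lt hK'.measure_lt_top
  obtain ⟨N, hN⟩ := ENNReal.exists_nat_mul_gt hpos hlt.ne
  exact (hbound N).not_gt hN

end TopologicalGroup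

/-! ### Unipotent and diagonal matrices in `SL(2, ℝ)` -/

section SpecialLinear

/-- The upper triangular unipotent matrix `(1 t; 0 1)`. -/
def upper (t : ℝ) : SL(2, ℝ) := ⟨!![1, t; 0, 1], by simp⟩

/-- The lower triangular unipotent matrix `(1 0; t 1)`. -/
def lower (t : ℝ) : SL(2, ℝ) := ⟨!![1, 0; t, 1], by simp⟩

/-- The diagonal matrix `(exp s 0; 0 exp (-s))`. -/
noncomputable def diag (s : ℝ) : SL(2, ℝ) :=
  ⟨!![Real.exp s, 0; 0, Real.exp (-s)], by simp [← Real.exp_add]⟩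

@[simp] theorem coe_upper (t : ℝ) : (upper t : Matrix (Fin 2) (Fin 2) ℝ) = !![1, t; 0, 1] := rfl

@[simp] theorem coe_lower (t : ℝ) : (lower t : Matrix (Fin 2) (Fin 2) ℝ) = !![1, 0; t, 1] := rfl

@[simp] theorem coe_diag (s : ℝ) :
    (diag s : Matrix (Fin 2) (Fin 2) ℝ) = !![Real.exp s, 0; 0, Real.exp (-s)] := rfl

theorem det_eq_one (h : SL(2, ℝ)) : h 0 0 * h 1 1 - h 0 1 * h 1 0 = 1 := by
  rw [← Matrix.det_fin_two, h.det_coe]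

theorem ext_entries {g h : SL(2, ℝ)} (h₀₀ : g 0 0 = h 0 0) (h₀₁ : g 0 1 = h 0 1)
    (h₁₀ : g 1 0 = h 1 0) (h₁₁ : g 1 1 = h 1 1) : g = h := by
  ext i j
  fin_cases i <;> fin_cases j <;> assumption

theorem mul_entry (g h : SL(2, ℝ)) (i j : Fin 2) :
    (g * h) i j = g i 0 * h 0 j + g i 1 * h 1 j := by
  rw [Matrix.SpecialLinearGroup.coe_mul, Matrix.mul_apply, Fin.sum_univ_two]

theorem inv_eq (g : SL(2, ℝ)) :
    ((g⁻¹ : SL(2, ℝ)) : Matrix (Fin 2) (Fin 2) ℝ) = !![g 1 1, -g 0 1; -g 1 0, g 0 0] := by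
  rw [Matrix.SpecialLinearGroup.coe_inv, Matrix.adjugate_fin_two]

theorem upper_add (s t : ℝ) : upper (s + t) = upper s * upper t := by
  refine ext_entries ?_ ?_ ?_ ?_ <;> simp [mul_entry, add_comm]

theorem upper_zero : upper 0 = 1 := by
  refine ext_entries ?_ ?_ ?_ ?_ <;> simp

theorem lower_zero : lower 0 = 1 := by
  refine ext_entries ?_ ?_ ?_ ?_ <;> simp

theorem upper_neg (t : ℝ) : upper (-t) = (upper t)⁻¹ := by
  rw [eq_inv_iff_mul_eq_one, ← upper_add, neg_add_cancel, upper_zero]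

theorem diag_add (s t : ℝ) : diag (s + t) = diag s * diag t := by
  refine ext_entries ?_ ?_ ?_ ?_ <;> simp [mul_entry, Real.exp_add, mul_comm]

theorem diag_zero : diag 0 = 1 := by
  refine ext_entries ?_ ?_ ?_ ?_ <;> simp

theorem diag_neg (s : ℝ) : diag (-s) = (diag s)⁻¹ := by
  rw [eq_inv_iff_mul_eq_one, ← diag_add, neg_add_cancel, diag_zero]

theorem diag_pow (s : ℝ) (n : ℕ) : diag s ^ n = diag (n * s) := by
  induction n with
  | zero => simp [diag_zero]
  | succ n ih => rw [pow_succ, ih, ← diag_add]; push_cast; ring_nf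

theorem upper_mul_diag (t s : ℝ) :
    upper t * diag s = diag s * upper (t * Real.exp (-(2 * s))) := by
  refine ext_entries ?_ ?_ ?_ ?_
  · simp [mul_entry]
  · simp only [mul_entry, coe_upper, coe_diag]
    simp only [Matrix.of_apply, Matrix.cons_val', Matrix.cons_val_zero, Matrix.cons_val_one,
      Matrix.cons_val_fin_one, mul_zero, mul_one, zero_add, add_zero]
    rw [mul_left_comm, ← Real.exp_add]
    ring_nf
  · simp [mul_entry]
  · simp [mul_entry]

theorem lower_mul_diag (t s : ℝ) :
    lower t * diag s = diag s * lower (t * Real.exp (2 * s)) := by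
  refine ext_entries ?_ ?_ ?_ ?_
  · simp [mul_entry]
  · simp [mul_entry]
  · simp only [mul_entry, coe_lower, coe_diag]
    simp only [Matrix.of_apply, Matrix.cons_val', Matrix.cons_val_zero, Matrix.cons_val_one,
      Matrix.cons_val_fin_one, mul_zero, mul_one, zero_add, add_zero]
    rw [mul_left_comm, ← Real.exp_add]
    ring_nf
  · simp [mul_entry]

theorem continuous_entry (i j : Fin 2) : Continuous fun h : SL(2, ℝ) => h i j :=
  (continuous_subtype_val : Continuous (Subtype.val : SL(2, ℝ) → Matrix (Fin 2) (Fin 2) ℝ)).matrix_elem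
    i j

theorem tendsto_of_entries {ι : Type*} {l : Filter ι} {f : ι → SL(2, ℝ)} {g : SL(2, ℝ)}
    (h : ∀ i j, Tendsto (fun x => f x i j) l (𝓝 (g i j))) : Tendsto f l (𝓝 g) := by
  refine tendsto_subtype_rng.2 ?_
  exact tendsto_pi_nhds.2 fun i => tendsto_pi_nhds.2 fun j => h i j

instance : LocallyCompactSpace SL(2, ℝ) := by
  have : LocallyCompactSpace (Matrix (Fin 2) (Fin 2) ℝ) :=
    inferInstanceAs (LocallyCompactSpace (Fin 2 → Fin 2 → ℝ))
  have hcl : IsClosed {A : Matrix (Fin 2) (Fin 2) ℝ | A.det = 1} :=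
    isClosed_eq (Continuous.matrix_det continuous_id) continuous_const
  exact hcl.isClosedEmbedding_subtypeVal.locallyCompactSpace

variable {G : Type*} [Group G] [TopologicalSpace G] [IsTopologicalGroup G] [T2Space G]
  {Γ : Subgroup (SL(2, ℝ) × G)} [DiscreteTopology Γ] {K : Set (SL(2, ℝ) × G)}

/-- A discrete cocompact subgroup has no element with a nontrivial unipotent first component. -/
theorem fst_eq_one_of_unipotent (hK : IsCompact K) (hΓK : ∀ h, ∃ γ ∈ Γ, γ * h ∈ K)
    {γ : SL(2, ℝ) × G} (hγ : γ ∈ Γ) (g : SL(2, ℝ) × G) (h₀ : (g⁻¹ * γ * g).1 0 0 = 1)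
    (h₁ : (g⁻¹ * γ * g).1 1 0 = 0) : (g⁻¹ * γ * g).1 = 1 := by
  set h := g⁻¹ * γ * g with hh
  have hd : h.1 1 1 = 1 := by
    have := det_eq_one h.1
    simpa [h₀, h₁] using this
  -- Conjugation by `diag s` multiplies the upper right entry by `exp (-2s)`, so the first component
  -- contracts to `1`; closedness of the conjugacy class then gives `γ.1 = 1`.
  have hlim : Tendsto (fun s : ℝ => (diag s, (1 : G))⁻¹ * h * (diag s, 1)) atTop
      (𝓝 (1, h.2)) := by
    refine Tendsto.prodMk_nhds (tendsto_of_entries fun i j => ?_) (by simp)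
    have hexp : Tendsto (fun s : ℝ => Real.exp (-s) * h.1 0 1 * Real.exp (-s)) atTop (𝓝 0) := by
      simpa using (Real.tendsto_exp_neg_atTop_nhds_zero.mul_const (h.1 0 1)).mul
        Real.tendsto_exp_neg_atTop_nhds_zero
    have he (s : ℝ) : Real.exp (-s) * Real.exp s = 1 := by simp [← Real.exp_add]
    have he' (s : ℝ) : Real.exp s * Real.exp (-s) = 1 := by simp [← Real.exp_add]
    fin_cases i <;> fin_cases j <;>
      simp [mul_entry, inv_eq, h₀, h₁, hd, he, he', hexp, -Matrix.SpecialLinearGroup.coe_mul,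
        -Matrix.SpecialLinearGroup.coe_inv]
  have hlim' : Tendsto (fun s : ℝ => (g * (diag s, (1 : G)))⁻¹ * γ * (g * (diag s, 1))) atTop
      (𝓝 (1, h.2)) := by
    refine hlim.congr fun s => ?_
    rw [hh]
    group
  obtain ⟨k, hk⟩ := exists_conj_eq_of_tendsto hK hΓK hγ hlim'
  have h1 : γ.1 = 1 := by
    have := congrArg Prod.fst hk
    simp only [Prod.fst_mul, Prod.fst_inv] at this
    have h2 : γ.1 = k.1 * (k.1⁻¹ * γ.1 * k.1) * k.1⁻¹ := by group
    rw [h2, ← this]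
    group
  simp [hh, h1]

end SpecialLinear

/-! ### Returns of the unipotent flow -/

section Returns

variable {G : Type*} [Group G] [TopologicalSpace G] [IsTopologicalGroup G] [T2Space G]
  {Γ : Subgroup (SL(2, ℝ) × G)} [DiscreteTopology Γ] {K : Set (SL(2, ℝ) × G)}

/-- Two elements of a discrete cocompact subgroup whose first components are upper triangular have
commuting first components. -/
theorem fst_commute_of_upper_triangular (hK : IsCompact K) (hΓK : ∀ h, ∃ γ ∈ Γ, γ * h ∈ K)
    {γ δ : SL(2, ℝ) × G} (hγ : γ ∈ Γ) (hδ : δ ∈ Γ) (g : SL(2, ℝ) × G)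
    (h₁ : (g⁻¹ * γ * g).1 1 0 = 0) (h₂ : (g⁻¹ * δ * g).1 1 0 = 0) :
    (g⁻¹ * γ * g).1 * (g⁻¹ * δ * g).1 = (g⁻¹ * δ * g).1 * (g⁻¹ * γ * g).1 := by
  set m := g⁻¹ * γ * g
  set n := g⁻¹ * δ * g
  have hc : g⁻¹ * (γ * δ * γ⁻¹ * δ⁻¹) * g = m * n * m⁻¹ * n⁻¹ := by
    simp only [m, n]
    group
  have hm : m.1 0 0 * m.1 1 1 = 1 := by simpa [h₁] using det_eq_one m.1
  have hn : n.1 0 0 * n.1 1 1 = 1 := by simpa [h₂] using det_eq_one n.1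
  -- The commutator of two upper triangular matrices is unipotent.
  have h := fst_eq_one_of_unipotent hK hΓK
    (Γ.mul_mem (Γ.mul_mem (Γ.mul_mem hγ hδ) (Γ.inv_mem hγ)) (Γ.inv_mem hδ)) g
    (by
      rw [hc]
      simp only [Prod.fst_mul, Prod.fst_inv, mul_entry, inv_eq]
      simp [h₁, h₂]
      linear_combination n.1 0 0 * n.1 1 1 * hm + hn)
    (by
      rw [hc]
      simp only [Prod.fst_mul, Prod.fst_inv, mul_entry, inv_eq]
      simp [h₁, h₂])
  rw [hc] at h
  have h' : m.1 * n.1 * m.1⁻¹ * n.1⁻¹ = 1 := h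
  rw [mul_inv_eq_one, mul_inv_eq_iff_eq_mul] at h'
  exact h'

/-- The returns of a recurrent point under the unipotent flow are not all upper triangular. -/
theorem exists_return_not_upper_triangular (hK : IsCompact K) (hΓK : ∀ h, ∃ γ ∈ Γ, γ * h ∈ K)
    (g : SL(2, ℝ) × G)
    (hrec : ∀ O ∈ 𝓝 (1 : SL(2, ℝ) × G), ∃ t ≥ 1, ∃ γ ∈ Γ, g⁻¹ * γ * g * (upper t, 1) ∈ O)
    {O : Set (SL(2, ℝ) × G)} (hO : O ∈ 𝓝 1) :
    ∃ t ≥ 1, ∃ γ ∈ Γ, g⁻¹ * γ * g * (upper t, 1) ∈ O ∧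
      (g⁻¹ * γ * g * (upper t, 1)).1 1 0 ≠ 0 := by
  by_contra! hcon
  have hcont (i j : Fin 2) : Continuous fun h : SL(2, ℝ) × G => h.1 i j :=
    (continuous_entry i j).comp continuous_fst
  have hO₁ : O ∩ {h | 1 / 2 < h.1 0 0 ∧ |h.1 0 1| < 1 / 4} ∈ 𝓝 (1 : SL(2, ℝ) × G) := by
    refine inter_mem hO (IsOpen.mem_nhds ?_ ?_)
    · exact (isOpen_lt continuous_const (hcont 0 0)).inter
        (isOpen_lt (hcont 0 1).abs continuous_const)
    · norm_num
  -- From `m₀₀ > 1/2`, `t ≥ 1` and `|m₀₀ t + m₀₁| < 1/4` follows `m₀₁ < -1/4`. Equal diagonal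
  -- entries would make `m.1` unipotent, hence `1`.
  have key {t : ℝ} (ht : 1 ≤ t) {γ : SL(2, ℝ) × G} (hγ : γ ∈ Γ)
      (hmem : g⁻¹ * γ * g * (upper t, 1) ∈ O ∩ {h | 1 / 2 < h.1 0 0 ∧ |h.1 0 1| < 1 / 4}) :
      (g⁻¹ * γ * g).1 1 0 = 0 ∧ 1 / 4 < |(g⁻¹ * γ * g).1 0 1| ∧
        (g⁻¹ * γ * g).1 0 0 - (g⁻¹ * γ * g).1 1 1 ≠ 0 := by
    have h0 := hcon t ht γ hγ hmem.1
    obtain ⟨-, h1, h2⟩ := hmem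
    have hnil := fst_eq_one_of_unipotent hK hΓK hγ g
    generalize g⁻¹ * γ * g = m at *
    have e00 : (m * (upper t, (1 : G))).1 0 0 = m.1 0 0 := by
      rw [Prod.fst_mul, mul_entry]; simp
    have e10 : (m * (upper t, (1 : G))).1 1 0 = m.1 1 0 := by
      rw [Prod.fst_mul, mul_entry]; simp
    have e01 : (m * (upper t, (1 : G))).1 0 1 = m.1 0 0 * t + m.1 0 1 := by
      rw [Prod.fst_mul, mul_entry]; simp
    rw [e00] at h1
    rw [e10] at h0
    rw [e01, abs_lt] at h2
    have hb : m.1 0 1 < -(1 / 4) := by nlinarith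
    refine ⟨h0, lt_abs.2 (Or.inr (by linarith)), fun had => ?_⟩
    have hdet := det_eq_one m.1
    rw [h0, ← sub_eq_zero.1 had] at hdet
    have ha : m.1 0 0 = 1 := by nlinarith
    have hm := hnil ha h0
    rw [hm] at hb
    norm_num at hb
  obtain ⟨t₀, ht₀, γ₀, hγ₀, hm₀⟩ := hrec _ hO₁
  obtain ⟨hc₀, hb₀, had₀⟩ := key ht₀ hγ₀ hm₀
  set n := g⁻¹ * γ₀ * g
  -- A second return `m` must commute with `n`, so `n₀₁ (m₀₀ - m₁₁) = m₀₁ (n₀₀ - n₁₁)`. The right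
  -- side exceeds `|n₀₀ - n₁₁| / 4` in absolute value; this neighbourhood makes the left side
  -- smaller.
  have hO₂ : {h : SL(2, ℝ) × G | |n.1 0 1 * (h.1 0 0 - h.1 1 1)| <
      |n.1 0 0 - n.1 1 1| / 4} ∈ 𝓝 (1 : SL(2, ℝ) × G) := by
    refine (isOpen_lt (by fun_prop) continuous_const).mem_nhds ?_
    simpa using had₀
  obtain ⟨t, ht, γ, hγ, hm⟩ := hrec _ (inter_mem hO₁ hO₂)
  obtain ⟨hc, hb, had⟩ := key ht hγ hm.1
  have hcomm := fst_commute_of_upper_triangular hK hΓK hγ hγ₀ g hc hc₀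
  have hm2 := hm.2
  change (g⁻¹ * γ * g).1 * n.1 = n.1 * (g⁻¹ * γ * g).1 at hcomm
  generalize g⁻¹ * γ * g = m at *
  have h01 := congrArg (fun h : SL(2, ℝ) => h 0 1) hcomm
  simp only [mul_entry] at h01
  have e00 : (m * (upper t, (1 : G))).1 0 0 = m.1 0 0 := by
    rw [Prod.fst_mul, mul_entry]; simp
  have e11 : (m * (upper t, (1 : G))).1 1 1 = m.1 1 1 := by
    rw [Prod.fst_mul, mul_entry]; simp [hc]
  rw [Set.mem_ofPred_eq, e00, e11] at hm2
  have h3 : n.1 0 1 * (m.1 0 0 - m.1 1 1) = m.1 0 1 * (n.1 0 0 - n.1 1 1) := by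
    linear_combination h01
  rw [h3, abs_mul] at hm2
  have := abs_pos.2 had₀
  nlinarith

end Returns

/-! ### Minimal sets of the unipotent flow -/

section MinimalSets

/-- The group of upper triangular unipotent matrices inside `SL(2, ℝ) × G`. -/
def upperSet (G : Type*) [Group G] : Set (SL(2, ℝ) × G) := Set.range fun t : ℝ => (upper t, 1)

variable {G : Type*} [Group G] [TopologicalSpace G] [IsTopologicalGroup G] [T2Space G]
  {Γ : Subgroup (SL(2, ℝ) × G)} {K M : Set (SL(2, ℝ) × G)}

omit [T2Space G] in
/-- Points of a minimal set are recurrent under the unipotent flow. -/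
theorem recurrent_of_minimal (hK : IsCompact K)
    (hΓK : ∀ h, ∃ γ ∈ Γ, γ * h ∈ K) (hM : Minimal (IsClosedInvariant Γ (upperSet G)) M)
    {g : SL(2, ℝ) × G} (hg : g ∈ M) {O : Set (SL(2, ℝ) × G)} (hO : O ∈ 𝓝 1) :
    ∃ t ≥ 1, ∃ γ ∈ Γ, g⁻¹ * γ * g * (upper t, 1) ∈ O := by
  -- The ω-limit set of `g` modulo `Γ`; it lies in `M`, so it equals `M` by minimality and contains
  -- `g`.
  set L : Set (SL(2, ℝ) × G) :=
    {p | ∀ W ∈ 𝓝 p, ∀ s : ℝ, ∃ t ≥ s, ∃ γ ∈ Γ, γ * g * (upper t, 1) ∈ W}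
  have hL : IsClosedInvariant Γ (upperSet G) L := by
    refine ⟨?_, ?_, ?_, ?_⟩
    · refine isClosed_of_closure_subset fun p hp W hW s => ?_
      obtain ⟨W', hW'W, hW'o, hpW'⟩ := mem_nhds_iff.1 hW
      obtain ⟨q, hqW', hq⟩ := mem_closure_iff.1 hp W' hW'o hpW'
      obtain ⟨t, ht, γ, hγ, h⟩ := hq W' (hW'o.mem_nhds hqW') s
      exact ⟨t, ht, γ, hγ, hW'W h⟩
    · choose δ hδ hδK using fun t : ℝ => hΓK (g * (upper t, 1))
      obtain ⟨p, -, hp⟩ := hK.exists_mapClusterPt (f := atTop) 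
        (u := fun t => δ t * (g * (upper t, 1)))
        (tendsto_principal.2 (Eventually.of_forall hδK))
      refine ⟨p, fun W hW s => ?_⟩
      obtain ⟨t, hts, ht⟩ := (frequently_atTop.1 (mapClusterPt_iff_frequently.1 hp W hW)) s
      exact ⟨t, hts, δ t, hδ t, by rwa [mul_assoc]⟩
    · intro δ hδ p hp W hW s
      obtain ⟨t, ht, γ, hγ, h⟩ := hp ((δ * ·) ⁻¹' W)
        ((continuous_const_mul δ).continuousAt.preimage_mem_nhds hW) s
      exact ⟨t, ht, δ * γ, Γ.mul_mem hδ hγ, by simpa [mul_assoc] using h⟩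
    · rintro p hp _ ⟨r, rfl⟩ W hW s
      obtain ⟨t, ht, γ, hγ, h⟩ := hp ((· * (upper r, 1)) ⁻¹' W)
        ((continuous_mul_const _).continuousAt.preimage_mem_nhds hW) (s - r)
      refine ⟨t + r, by linarith, γ, hγ, ?_⟩
      simpa [mul_assoc, upper_add] using h
  have hLM : L ⊆ M := by
    intro p hp
    refine hM.prop.isClosed.closure_subset (mem_closure_iff.2 fun W hW hpW => ?_)
    obtain ⟨t, -, γ, hγ, h⟩ := hp W (hW.mem_nhds hpW) 0
    exact ⟨_, h, hM.prop.right_mem _ (hM.prop.left_mem _ hγ _ hg) _ ⟨t, rfl⟩⟩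
  have hgL : g ∈ L := hM.le_of_le hL hLM hg
  obtain ⟨t, ht, γ, hγ, h⟩ := hgL ((g⁻¹ * ·) ⁻¹' O)
    ((continuous_const_mul g⁻¹).continuousAt.preimage_mem_nhds (by simpa using hO)) 1
  exact ⟨t, ht, γ, hγ, by simpa [mul_assoc] using h⟩

variable [DiscreteTopology Γ]

/-- A minimal set for the unipotent flow is invariant under the diagonal flow. -/
theorem mul_diag_mem_of_minimal (hK : IsCompact K)
    (hΓK : ∀ h, ∃ γ ∈ Γ, γ * h ∈ K) (hM : Minimal (IsClosedInvariant Γ (upperSet G)) M)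
    {m : SL(2, ℝ) × G} (hm : m ∈ M) (s : ℝ) : m * (diag s, 1) ∈ M := by
  obtain ⟨g, hg⟩ := hM.prop.nonempty
  have hup {h : SL(2, ℝ) × G} (hh : h ∈ M) (t : ℝ) : h * (upper t, 1) ∈ M :=
    hM.prop.right_mem _ hh _ ⟨t, rfl⟩
  have hret (O : Set (SL(2, ℝ) × G)) (hO : O ∈ 𝓝 1) :
      ∃ ε ∈ O, g * ε ∈ M ∧ ε.1 1 0 ≠ 0 := by
    obtain ⟨t, -, γ, hγ, hmem, hne⟩ := exists_return_not_upper_triangular hK hΓK g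
      (fun O hO => recurrent_of_minimal hK hΓK hM hg hO) hO
    refine ⟨_, hmem, ?_, hne⟩
    have := hup (hM.prop.left_mem γ hγ g hg) t
    convert this using 1
    group
  set l : Filter (SL(2, ℝ) × G) := 𝓝 1 ⊓ 𝓟 {ε | g * ε ∈ M ∧ ε.1 1 0 ≠ 0}
  have hl : l.NeBot := by
    refine inf_principal_neBot_iff.2 fun O hO => ?_
    obtain ⟨ε, h, h'⟩ := hret O hO
    exact ⟨ε, h, h'⟩
  -- Chosen so that `upper (-x ε) * ε.1` has upper left entry `exp s`; a right factor `upper t` then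
  -- kills the upper right entry.
  set x : SL(2, ℝ) × G → ℝ := fun ε => (ε.1 0 0 - Real.exp s) / ε.1 1 0
  choose δ hδ hδK using fun ε => hΓK (g * (upper (x ε), 1))
  have hfac (ε : SL(2, ℝ) × G) (hε : ε.1 1 0 ≠ 0) : ∃ t, (upper (-x ε) * ε.1 * upper t) 0 0 =
      Real.exp s ∧ (upper (-x ε) * ε.1 * upper t) 0 1 = 0 ∧
      (upper (-x ε) * ε.1 * upper t) 1 0 = ε.1 1 0 := by
    have hx : x ε * ε.1 1 0 = ε.1 0 0 - Real.exp s := div_mul_cancel₀ _ hε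
    refine ⟨(x ε * ε.1 1 1 - ε.1 0 1) / Real.exp s, ?_, ?_, ?_⟩
    · simp only [mul_entry]
      simp [hx]
    · simp only [mul_entry]
      simp only [coe_upper, Matrix.of_apply, Matrix.cons_val', Matrix.cons_val_zero,
        Matrix.cons_val_one, Matrix.cons_val_fin_one]
      have hy : 1 * ε.1 0 0 + -x ε * ε.1 1 0 = Real.exp s := by linarith
      rw [hy, mul_div_cancel₀ _ (Real.exp_pos s).ne']
      ring
    · simp only [mul_entry]
      simp
  have hfac' (ε : SL(2, ℝ) × G) : ∃ t, ε.1 1 0 ≠ 0 → (upper (-x ε) * ε.1 * upper t) 0 0 =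
      Real.exp s ∧ (upper (-x ε) * ε.1 * upper t) 0 1 = 0 ∧
      (upper (-x ε) * ε.1 * upper t) 1 0 = ε.1 1 0 := by
    by_cases hε : ε.1 1 0 = 0
    · exact ⟨0, fun h => absurd hε h⟩
    · obtain ⟨t, ht⟩ := hfac ε hε
      exact ⟨t, fun _ => ht⟩
  choose t ht using hfac'
  set F := Ultrafilter.of l
  have hFl : (F : Filter (SL(2, ℝ) × G)) ≤ l := Ultrafilter.of_le l
  have hF1 : (F : Filter (SL(2, ℝ) × G)) ≤ 𝓝 1 := hFl.trans inf_le_left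
  have hFM : ∀ᶠ ε in F, g * ε ∈ M ∧ ε.1 1 0 ≠ 0 :=
    hFl (mem_inf_of_right (mem_principal_self _))
  obtain ⟨p, -, hp⟩ := hK.ultrafilter_le_nhds (F.map fun ε => δ ε * (g * (upper (x ε), 1)))
    (le_principal_iff.2 (Ultrafilter.mem_map.2 (univ_mem' hδK)))
  have hp : Tendsto (fun ε => δ ε * (g * (upper (x ε), 1))) F (𝓝 p) := hp
  have hpM : p ∈ M := hM.prop.isClosed.mem_of_tendsto hp
    (Eventually.of_forall fun ε => hM.prop.left_mem _ (hδ ε) _ (hup hg _))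
  have hq : Tendsto (fun ε : SL(2, ℝ) × G => (upper (-x ε) * ε.1 * upper (t ε), ε.2)) F
      (𝓝 (diag s, 1)) := by
    have h10 : Tendsto (fun ε : SL(2, ℝ) × G => ε.1 1 0) F (𝓝 0) := by
      have h : Tendsto (fun ε : SL(2, ℝ) × G => ε.1 1 0) F (𝓝 ((1 : SL(2, ℝ) × G).1 1 0)) :=
        (((continuous_entry 1 0).comp continuous_fst).tendsto (1 : SL(2, ℝ) × G)).mono_left hF1
      simpa using h
    refine Tendsto.prodMk_nhds (tendsto_of_entries fun i j => ?_)
      ((continuous_snd.tendsto (1 : SL(2, ℝ) × G)).mono_left hF1)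
    fin_cases i <;> fin_cases j
    · refine tendsto_const_nhds.congr' ?_
      filter_upwards [hFM] with ε hε using (ht ε hε.2).1.symm
    · refine tendsto_const_nhds.congr' ?_
      filter_upwards [hFM] with ε hε using (ht ε hε.2).2.1.symm
    · refine h10.congr' ?_
      filter_upwards [hFM] with ε hε using (ht ε hε.2).2.2.symm
    · refine tendsto_const_nhds.congr' ?_
      filter_upwards [hFM] with ε hε
      have hdet := det_eq_one (upper (-x ε) * ε.1 * upper (t ε))
      rw [(ht ε hε.2).1, (ht ε hε.2).2.1, zero_mul, sub_zero] at hdet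
      change Real.exp (-s) = (upper (-x ε) * ε.1 * upper (t ε)) 1 1
      rw [Real.exp_neg]
      exact (eq_inv_of_mul_eq_one_right hdet).symm
  -- The product inside the limit telescopes to `δ ε * g * ε * upper (t ε)`, a point of `M`.
  have hpD : p * (diag s, 1) ∈ M := by
    refine hM.prop.isClosed.mem_of_tendsto (hp.mul hq) ?_
    filter_upwards [hFM] with ε hε
    have := hM.prop.left_mem _ (hδ ε) _ (hup hε.1 (t ε))
    convert this using 1
    rw [upper_neg]
    ext1 <;> simp [mul_assoc]
  -- Since `diag s` normalizes the unipotent group, one point `p` suffices by minimality.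
  have hM' : IsClosedInvariant Γ (upperSet G) {h | h ∈ M ∧ h * (diag s, 1) ∈ M} := by
    refine ⟨?_, ⟨p, hpM, hpD⟩, ?_, ?_⟩
    · exact hM.prop.isClosed.inter (hM.prop.isClosed.preimage (continuous_mul_const _))
    · rintro γ hγ h ⟨h1, h2⟩
      exact ⟨hM.prop.left_mem γ hγ h h1, by simpa [mul_assoc] using hM.prop.left_mem γ hγ _ h2⟩
    · rintro h ⟨h1, h2⟩ _ ⟨r, rfl⟩
      refine ⟨hup h1 r, ?_⟩
      convert hup h2 (r * Real.exp (-(2 * s))) using 1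
      ext1 <;> simp [mul_assoc, upper_mul_diag]
  exact (hM.le_of_le hM' (fun h hh => hh.1) hm).2

omit [T2Space G] in
-- The Weyl element conjugates `diag s` to its inverse, so the character there is nonnegative with
-- square `1`.
theorem modularCharacter_diag [LocallyCompactSpace G] (s : ℝ) :
    modularCharacter ((diag s, 1) : SL(2, ℝ) × G) = 1 := by
  set w : SL(2, ℝ) := ⟨!![0, 1; -1, 0], by simp⟩ with hw
  have hconj : ((w, 1) : SL(2, ℝ) × G) * (diag s, 1) = (diag (-s), 1) * (w, 1) := by
    ext1
    · simp only [Prod.fst_mul]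
      refine ext_entries ?_ ?_ ?_ ?_ <;> simp only [mul_entry] <;> simp [hw]
    · simp
  have hinv : ((diag (-s), 1) : SL(2, ℝ) × G) * (diag s, 1) = 1 := by
    simp [diag_neg]
  have hw0 : modularCharacter ((w, 1) : SL(2, ℝ) × G) ≠ 0 := (modularCharacterFun_pos _).ne'
  have h1 := congrArg (modularCharacter (G := SL(2, ℝ) × G)) hconj
  have h2 := congrArg (modularCharacter (G := SL(2, ℝ) × G)) hinv
  rw [map_mul, map_mul, mul_comm] at h1
  rw [map_mul, map_one, ← mul_right_cancel₀ hw0 h1] at h2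
  exact (pow_eq_one_iff_of_nonneg zero_le two_ne_zero).1 (by rw [sq, h2])

theorem exists_diag_upper_lower {q : SL(2, ℝ)} (hq : 0 < q 1 1) :
    ∃ s t, q = diag s * upper t * lower (q 1 0 / q 1 1) := by
  have he : Real.exp (-Real.log (q 1 1)) = (q 1 1)⁻¹ := by rw [Real.exp_neg, Real.exp_log hq]
  refine ⟨-Real.log (q 1 1), q 0 1 * q 1 1, ext_entries ?_ ?_ ?_ ?_⟩
  · simp only [mul_entry]
    simp only [coe_upper, coe_lower, coe_diag, Matrix.of_apply, Matrix.cons_val',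
      Matrix.cons_val_zero, Matrix.cons_val_one, Matrix.cons_val_fin_one, he]
    field_simp
    linear_combination det_eq_one q
  · simp only [mul_entry]
    simp [he]
    field_simp
  · simp only [mul_entry]
    simp [Real.exp_log hq]
    field_simp
  · simp only [mul_entry]
    simp [Real.exp_log hq]

omit [T2Space G] in
/-- A closed set which is invariant under the upper triangular unipotent flow and the diagonal flow
is invariant under the lower triangular unipotent flow. -/
theorem mul_lower_mem [LocallyCompactSpace G] (hK : IsCompact K) (hΓK : ∀ h, ∃ γ ∈ Γ, γ * h ∈ K)
    (hM : IsClosedInvariant Γ (upperSet G) M) (hdiag : ∀ m ∈ M, ∀ s, m * (diag s, 1) ∈ M)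
    {m : SL(2, ℝ) × G} (hm : m ∈ M) (r : ℝ) : m * (lower r, 1) ∈ M := by
  set y : SL(2, ℝ) × G := m * (lower r, 1) with hy
  refine hM.isClosed.closure_subset (mem_closure_iff.2 fun W hWo hyW => ?_)
  obtain ⟨O₁, hO₁, hO₁W⟩ : ∃ O ∈ 𝓝 (1 : SL(2, ℝ) × G), ∀ v ∈ O, ∀ u ∈ O, y * v * u⁻¹ ∈ W := by
    have hc : Continuous fun p : (SL(2, ℝ) × G) × (SL(2, ℝ) × G) => y * p.1 * p.2⁻¹ := by fun_prop
    have h : (fun p : (SL(2, ℝ) × G) × (SL(2, ℝ) × G) => y * p.1 * p.2⁻¹) ⁻¹' W ∈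
        𝓝 ((1 : SL(2, ℝ) × G), (1 : SL(2, ℝ) × G)) :=
      hc.continuousAt.preimage_mem_nhds (by simpa using hWo.mem_nhds hyW)
    rw [nhds_prod_eq, mem_prod_same_iff] at h
    obtain ⟨O, hO, h⟩ := h
    exact ⟨O, hO, fun v hv u hu => h (Set.mk_mem_prod hv hu)⟩
  obtain ⟨η, hη, V, hV, hηV⟩ : ∃ η > 0, ∃ V ∈ 𝓝 (1 : G), ∀ ρ : ℝ, |ρ| < η → ∀ v ∈ V,
      (lower ρ, v) ∈ O₁ := by
    have hO₁' : O₁ ∈ 𝓝 ((1 : SL(2, ℝ)), (1 : G)) := hO₁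
    rw [nhds_prod_eq, mem_prod_iff] at hO₁'
    obtain ⟨S, hS, V, hV, hSV⟩ := hO₁'
    have hlow : Tendsto lower (𝓝 0) (𝓝 1) := by
      rw [← lower_zero]
      refine tendsto_of_entries fun i j => ?_
      fin_cases i <;> fin_cases j
      · simp
      · simp
      · exact tendsto_id
      · simp
    obtain ⟨η, hη, hηS⟩ := Metric.mem_nhds_iff.1 (hlow hS)
    exact ⟨η, hη, V, hV, fun ρ hρ v hv => hSV ⟨hηS (by simpa using hρ), hv⟩⟩
  have hcont (i j : Fin 2) : Continuous fun h : SL(2, ℝ) × G => (lower r * h.1) i j :=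
    (continuous_entry i j).comp (by fun_prop)
  -- Keeps the lower unipotent coordinate `ρ` of `lower r * u.1` below `|r| + 1`, a bound fixed
  -- before `s` is chosen.
  have hO₂ : {h : SL(2, ℝ) × G | 0 < (lower r * h.1) 1 1 ∧
      |(lower r * h.1) 1 0| < (|r| + 1) * (lower r * h.1) 1 1} ∈ 𝓝 1 := by
    refine IsOpen.mem_nhds ((isOpen_lt continuous_const (hcont 1 1)).inter
      (isOpen_lt (hcont 1 0).abs (continuous_const.mul (hcont 1 1)))) ?_
    simp
  obtain ⟨s, hs0, hs⟩ : ∃ s > 0, (|r| + 1) * Real.exp (-s) < η := by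
    have h : Tendsto (fun s => (|r| + 1) * Real.exp (-s)) atTop (𝓝 0) := by
      simpa using Real.tendsto_exp_neg_atTop_nhds_zero.const_mul (|r| + 1)
    exact ((eventually_gt_atTop 0).and (h.eventually_lt_const hη)).exists
  obtain ⟨n, hn, γ, hγ, u, ⟨⟨-, hu2⟩, hu⟩, v, ⟨⟨hv, -⟩, -⟩, huv⟩ :=
    exists_return hK hΓK (modularCharacter_diag (-s)) y
      (inter_mem (inter_mem hO₁ (continuous_snd.continuousAt.preimage_mem_nhds hV)) hO₂)
  obtain ⟨hq, hqr⟩ := hu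
  obtain ⟨σ, t, hfac⟩ := exists_diag_upper_lower hq
  set ρ := (lower r * u.1) 1 0 / (lower r * u.1) 1 1
  have hρ : |ρ| < |r| + 1 := by
    rw [abs_div, abs_of_pos hq, div_lt_iff₀ hq]
    exact hqr
  have hρn : |ρ * Real.exp (2 * (n * -s))| < η := by
    rw [abs_mul, Real.abs_exp]
    refine lt_of_le_of_lt (mul_le_mul hρ.le (Real.exp_le_exp.2 ?_) (Real.exp_pos _).le
      (by positivity)) hs
    have : (1 : ℝ) ≤ n := by exact_mod_cast hn
    nlinarith
  have hmem : γ * (m * (diag σ, 1) * (upper t, 1) * (diag (n * -s), 1)) ∈ M :=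
    hM.left_mem γ hγ _ (hdiag _ (hM.right_mem _ (hdiag m hm σ) _ ⟨t, rfl⟩) _)
  refine ⟨_, ?_, hmem⟩
  -- Moving `lower ρ` past `diag (n * -s)` shrinks it below `η`, so the point of `M` on the left is
  -- close to `y`.
  have heq : γ * (m * (diag σ, 1) * (upper t, 1) * (diag (n * -s), 1)) =
      y * v * (lower (ρ * Real.exp (2 * (n * -s))), u.2)⁻¹ := by
    rw [eq_mul_inv_iff_mul_eq, ← huv, hy]
    have h1 : (m * (lower r, 1) * u) = m * (diag σ * upper t * lower ρ, u.2) := by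
      rw [mul_assoc, ← hfac]
      congr 1
      ext1 <;> simp
    have h2 : ((diag (-s), 1) : SL(2, ℝ) × G) ^ n = (diag (n * -s), 1) := by
      rw [Prod.pow_mk, diag_pow, one_pow]
    rw [h1, h2]
    ext1
    · simp only [Prod.fst_mul]
      simp only [mul_assoc, lower_mul_diag]
    · simp [mul_assoc]
  rw [heq]
  exact hO₁W _ hv _ (hηV _ hρn _ hu2)

theorem exists_upper_lower_upper {q : SL(2, ℝ)} (hq : q 1 0 ≠ 0) :
    ∃ s t, q = upper s * lower (q 1 0) * upper t := by
  refine ⟨(q 0 0 - 1) / q 1 0, (q 1 1 - 1) / q 1 0, ext_entries ?_ ?_ ?_ ?_⟩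
  · simp only [mul_entry]
    simp [hq]
  · simp only [mul_entry]
    simp [hq]
    field_simp
    linear_combination - det_eq_one q
  · simp only [mul_entry]
    simp
  · simp only [mul_entry]
    simp [hq, mul_div_cancel₀]

/-- If the projection of a discrete cocompact subgroup `Γ` to `G` is dense, then every nonempty
closed set which is invariant under `Γ` and the upper triangular unipotent flow is everything. -/
theorem IsClosedInvariant.eq_univ [LocallyCompactSpace G] (hK : IsCompact K)
    (hΓK : ∀ h, ∃ γ ∈ Γ, γ * h ∈ K) (hΓ : Dense (Prod.snd '' (Γ : Set (SL(2, ℝ) × G))))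
    (hM : IsClosedInvariant Γ (upperSet G) M) : M = Set.univ := by
  obtain ⟨N, hNM, hN⟩ := hM.exists_minimal hK hΓK
  refine Set.eq_univ_of_univ_subset (Set.Subset.trans ?_ hNM)
  have hup {h : SL(2, ℝ) × G} (hh : h ∈ N) (t : ℝ) : h * (upper t, 1) ∈ N :=
    hN.prop.right_mem _ hh _ ⟨t, rfl⟩
  have hlow {h : SL(2, ℝ) × G} (hh : h ∈ N) (t : ℝ) : h * (lower t, 1) ∈ N :=
    mul_lower_mem hK hΓK hN.prop (fun _ hm s => mul_diag_mem_of_minimal hK hΓK hN hm s) hh t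
  have hne {h : SL(2, ℝ) × G} (hh : h ∈ N) (q : SL(2, ℝ)) (hq : q 1 0 ≠ 0) : h * (q, 1) ∈ N := by
    obtain ⟨s, t, hst⟩ := exists_upper_lower_upper hq
    convert hup (hlow (hup hh s) (q 1 0)) t using 1
    conv_lhs => rw [hst]
    ext1 <;> simp [mul_assoc]
  have hall {h : SL(2, ℝ) × G} (hh : h ∈ N) (q : SL(2, ℝ)) : h * (q, 1) ∈ N := by
    by_cases hq : q 1 0 = 0
    · have hd : q 1 1 ≠ 0 := by
        intro hd
        have := det_eq_one q
        simp [hq, hd] at this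
      -- An upper triangular `q` leaves the upper triangular group after multiplication by `lower
      -- 1`, which is then undone.
      have h1 := hlow (hne hh (q * lower 1) (by simp only [mul_entry]; simpa [hq] using hd)) (-1)
      have hinv : lower 1 * lower (-1) = 1 := by
        refine ext_entries ?_ ?_ ?_ ?_ <;> simp only [mul_entry] <;> simp
      convert h1 using 1
      ext1 <;> simp [mul_assoc, hinv]
    · exact hne hh q hq
  obtain ⟨⟨f₀, c⟩, hfc⟩ := hN.prop.nonempty
  rintro ⟨f, x⟩ -
  -- The slice of `N` over `f`: `Γ` moves the second coordinate, and `SL(2, ℝ)`-invariance restores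
  -- the first to `f`.
  have hcl : IsClosed {z : G | (f, z * c) ∈ N} := hN.prop.isClosed.preimage (by fun_prop)
  have hsub : Prod.snd '' (Γ : Set (SL(2, ℝ) × G)) ⊆ {z : G | (f, z * c) ∈ N} := by
    rintro _ ⟨γ, hγ, rfl⟩
    have := hall (hN.prop.left_mem γ hγ _ hfc) ((γ.1 * f₀)⁻¹ * f)
    have heq : γ * (f₀, c) * ((γ.1 * f₀)⁻¹ * f, 1) = (f, γ.2 * c) := by
      ext1 <;> simp [mul_assoc]
    rwa [heq] at this
  have hx : x * c⁻¹ ∈ {z : G | (f, z * c) ∈ N} := closure_minimal hsub hcl (hΓ _)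
  simpa using hx

end MinimalSets

/-! ### Passage between `X` and `SL(2, ℝ) × G` -/

section Quotient

variable {G : Type*} [Group G]

theorem X.surjective_mk (Γ : Subgroup (PSL(2, ℝ) × G)) : Function.Surjective (X.mk Γ) :=
  Quotient.mk_surjective

theorem X.mk_mul {Γ : Subgroup (PSL(2, ℝ) × G)} {γ : PSL(2, ℝ) × G} (hγ : γ ∈ Γ)
    (h : PSL(2, ℝ) × G) : X.mk Γ (γ * h) = X.mk Γ h :=
  (X.mk_eq_mk.2 ⟨γ, hγ, rfl⟩).symm

variable [TopologicalSpace G]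

theorem X.continuous_mk (Γ : Subgroup (PSL(2, ℝ) × G)) : Continuous (X.mk Γ) :=
  continuous_quot_mk

variable [IsTopologicalGroup G] (Γ : Subgroup (PSL(2, ℝ) × G))

theorem X.isOpenMap_mk : IsOpenMap (X.mk Γ) := by
  intro V hV
  refine isOpen_coinduced.2 ?_
  have h : X.mk Γ ⁻¹' (X.mk Γ '' V) = ⋃ γ : Γ, ((γ : PSL(2, ℝ) × G) * ·) ⁻¹' V := by
    ext k
    simp only [Set.mem_preimage, Set.mem_image, Set.mem_iUnion]
    constructor
    · rintro ⟨v, hv, hvk⟩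
      obtain ⟨γ, hγ, rfl⟩ := X.mk_eq_mk.1 hvk.symm
      exact ⟨⟨γ, hγ⟩, hv⟩
    · rintro ⟨γ, hγ⟩
      exact ⟨_, hγ, X.mk_mul γ.2 k⟩
  change IsOpen (X.mk Γ ⁻¹' (X.mk Γ '' V))
  rw [h]
  exact isOpen_iUnion fun γ => hV.preimage (continuous_const_mul _)

instance : ContinuousConstSMul PSL(2, ℝ)ᵐᵒᵖ (X Γ) where
  continuous_const_smul f := by
    refine continuous_coinduced_dom.2 ?_
    change Continuous fun h : PSL(2, ℝ) × G => X.mk Γ (h.1 * f.unop, h.2)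
    exact (X.continuous_mk Γ).comp (by fun_prop)

/-- `PSL(2, ℝ)`-orbits in `X` correspond to orbits of `p₂(Γ)` acting on `G` by left translation. -/
theorem isMinimal_iff_dense_map_snd :
    MulAction.IsMinimal PSL(2, ℝ)ᵐᵒᵖ (X Γ) ↔
      Dense (Γ.map (MonoidHom.snd PSL(2, ℝ) G) : Set G) := by
  constructor
  · intro h
    refine dense_iff_inter_open.2 fun V hV ⟨v, hv⟩ => ?_
    obtain ⟨_, ⟨⟨f, z⟩, hz, hfz⟩, ⟨a, rfl⟩⟩ := dense_iff_inter_open.1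
      (h.dense_orbit (X.mk Γ (1, 1))) _ (X.isOpenMap_mk Γ _ (hV.preimage continuous_snd))
      ⟨_, (1, v), hv, rfl⟩
    obtain ⟨γ, hγ, h'⟩ := X.mk_eq_mk.1
      (hfz.trans (X.op_smul_mk Γ 1 a.unop 1) : X.mk Γ (f, z) = X.mk Γ (1 * a.unop, 1))
    refine ⟨z, hz, γ⁻¹, Γ.inv_mem hγ, ?_⟩
    have h2 : γ.2 * z = 1 := congrArg Prod.snd h'
    exact inv_eq_of_mul_eq_one_right h2
  · refine fun h => ⟨fun x => dense_iff_inter_open.2 fun V hV ⟨v, hv⟩ => ?_⟩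
    obtain ⟨⟨f, g⟩, rfl⟩ := X.surjective_mk Γ x
    obtain ⟨⟨f₁, g₁⟩, rfl⟩ := X.surjective_mk Γ v
    have hopen : IsOpen {z : G | X.mk Γ (f₁, z * g) ∈ V} :=
      hV.preimage ((X.continuous_mk Γ).comp (by fun_prop))
    obtain ⟨_, hz, ⟨γ, hγ, rfl⟩⟩ := dense_iff_inter_open.1 h _ hopen
      ⟨g₁ * g⁻¹, by simpa using hv⟩
    refine ⟨_, hz, MulOpposite.op (f⁻¹ * (γ.1⁻¹ * f₁)), ?_⟩
    change MulOpposite.op (f⁻¹ * (γ.1⁻¹ * f₁)) • X.mk Γ (f, g) = _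
    rw [X.op_smul_mk, mul_inv_cancel_left, ← X.mk_mul hγ]
    congr 1
    ext1 <;> simp

/-- The projection `SL(2, ℝ) × G → PSL(2, ℝ) × G`. -/
def toPSL (G : Type*) [Group G] : SL(2, ℝ) × G →* PSL(2, ℝ) × G :=
  (QuotientGroup.mk' _).prodMap (MonoidHom.id G)

omit [TopologicalSpace G] [IsTopologicalGroup G] in
theorem surjective_toPSL : Function.Surjective (toPSL G) := by
  rintro ⟨f, g⟩
  obtain ⟨f, rfl⟩ := QuotientGroup.mk_surjective f
  exact ⟨(f, g), rfl⟩

omit [IsTopologicalGroup G] in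
theorem continuous_toPSL : Continuous (toPSL G) :=
  (QuotientGroup.continuous_mk (N := Subgroup.center SL(2, ℝ))).prodMap continuous_id

omit [IsTopologicalGroup G] in
theorem isOpenMap_toPSL : IsOpenMap (toPSL G) :=
  (QuotientGroup.isOpenMap_coe (N := Subgroup.center SL(2, ℝ))).prodMap IsOpenMap.id

/-- The kernel of `toPSL G` is `{±1}`, and positivity of the upper left entry separates `1` from
`-1`. -/
theorem discreteTopology_comap_toPSL [DiscreteTopology Γ] :
    DiscreteTopology (Γ.comap (toPSL G)) := by
  refine discreteTopology_of_isOpen_singleton_one ?_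
  obtain ⟨D, hD, hDΓ⟩ := isOpen_induced_iff.1 (isOpen_discrete ({1} : Set Γ))
  refine isOpen_induced_iff.2 ⟨toPSL G ⁻¹' D ∩ {h | 0 < h.1 0 0},
    (hD.preimage continuous_toPSL).inter
      (isOpen_lt continuous_const ((continuous_entry 0 0).comp continuous_fst)), ?_⟩
  ext ⟨⟨f, g⟩, hγ⟩
  constructor
  · rintro ⟨h1, h2⟩
    have h3 : (⟨toPSL G (f, g), hγ⟩ : Γ) ∈ ({1} : Set Γ) := hDΓ ▸ h1
    have h4 : toPSL G (f, g) = 1 := congrArg Subtype.val h3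
    have hg : g = 1 := congrArg Prod.snd h4
    have hf : (f : PSL(2, ℝ)) = 1 := congrArg Prod.fst h4
    obtain ⟨r, hr, hrf⟩ := Matrix.SpecialLinearGroup.mem_center_iff.1
      ((QuotientGroup.eq_one_iff f).1 hf)
    have h00 : f 0 0 = r := by rw [← hrf]; simp
    have hr0 : 0 < r := h00 ▸ h2
    have hr1 : r = 1 := (pow_eq_one_iff_of_nonneg hr0.le (by simp)).1 hr
    have hf1 : f = 1 := Subtype.ext (by rw [← hrf, hr1]; simp)
    simp [hg, hf1]
  · intro h
    have h1 : ((f, g) : SL(2, ℝ) × G) = 1 := congrArg Subtype.val h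
    refine ⟨?_, ?_⟩
    · have : (1 : Γ) ∈ Subtype.val ⁻¹' D := hDΓ ▸ rfl
      simpa [h1] using this
    · simp [h1]

theorem exists_compact_comap_toPSL [LocallyCompactSpace G] [CompactSpace (X Γ)] :
    ∃ K : Set (SL(2, ℝ) × G), IsCompact K ∧ ∀ h, ∃ γ ∈ Γ.comap (toPSL G), γ * h ∈ K := by
  choose C hC hCx using fun h : SL(2, ℝ) × G => exists_compact_mem_nhds h
  have hopen : IsOpenMap (X.mk Γ ∘ toPSL G) := (X.isOpenMap_mk Γ).comp isOpenMap_toPSL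
  obtain ⟨F, hF⟩ := (isCompact_univ (X := X Γ)).elim_finite_subcover
    (fun h => (X.mk Γ ∘ toPSL G) '' interior (C h)) (fun h => hopen _ isOpen_interior) (by
      intro x _
      obtain ⟨h, rfl⟩ := ((X.surjective_mk Γ).comp surjective_toPSL) x
      exact Set.mem_iUnion.2 ⟨h, h, mem_interior_iff_mem_nhds.2 (hCx h), rfl⟩)
  refine ⟨⋃ h ∈ F, C h, F.isCompact_biUnion fun h _ => hC h, fun h => ?_⟩
  obtain ⟨i, hi, k, hk, hkh⟩ := Set.mem_iUnion₂.1 (hF (Set.mem_univ ((X.mk Γ ∘ toPSL G) h)))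
  obtain ⟨γ, hγ, h'⟩ := X.mk_eq_mk.1 hkh.symm
  refine ⟨k * h⁻¹, ?_, Set.mem_biUnion hi (by simpa using interior_subset hk)⟩
  have : toPSL G (k * h⁻¹) = γ := by rw [map_mul, map_inv, ← h', mul_inv_cancel_right]
  rwa [Subgroup.mem_comap, this]

/-- The preimage of a `U`-orbit closure is a closed invariant set, to which
`IsClosedInvariant.eq_univ` applies. -/
theorem isMinimal_U_of_dense [T2Space G] [LocallyCompactSpace G] [DiscreteTopology Γ]
    [CompactSpace (X Γ)] (hΓ : Dense (Γ.map (MonoidHom.snd PSL(2, ℝ) G) : Set G)) :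
    MulAction.IsMinimal U.op (X Γ) := by
  have := discreteTopology_comap_toPSL Γ
  obtain ⟨K, hK, hΓK⟩ := exists_compact_comap_toPSL Γ
  refine ⟨fun x => ?_⟩
  have hsurj : Function.Surjective (X.mk Γ ∘ toPSL G) :=
    (X.surjective_mk Γ).comp surjective_toPSL
  have hM : IsClosedInvariant (Γ.comap (toPSL G)) (upperSet G)
      ((X.mk Γ ∘ toPSL G) ⁻¹' closure (MulAction.orbit U.op x)) := by
    refine ⟨isClosed_closure.preimage ((X.continuous_mk Γ).comp continuous_toPSL), ?_, ?_, ?_⟩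
    · obtain ⟨h, hh⟩ := hsurj x
      exact ⟨h, by rw [Set.mem_preimage, hh]; exact subset_closure (MulAction.mem_orbit_self x)⟩
    · intro γ hγ h hh
      have heq : X.mk Γ (toPSL G (γ * h)) = X.mk Γ (toPSL G h) := by
        rw [map_mul]
        exact X.mk_mul hγ _
      rwa [Set.mem_preimage, Function.comp_apply, heq]
    · rintro ⟨f, g⟩ hh _ ⟨t, rfl⟩
      have hu : (upper t : PSL(2, ℝ)) ∈ U := ⟨upper t, ⟨t, rfl⟩, rfl⟩
      have heq : X.mk Γ (toPSL G ((f, g) * (upper t, 1))) =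
          MulOpposite.op (upper t : PSL(2, ℝ)) • X.mk Γ (toPSL G (f, g)) := by
        change _ = X.mk Γ ((f : PSL(2, ℝ)) * (upper t : PSL(2, ℝ)), g)
        congr 1
        ext1
        · rfl
        · exact mul_one g
      rw [Set.mem_preimage, Function.comp_apply, heq]
      refine map_mem_closure (continuous_const_smul _) hh ?_
      rintro _ ⟨a, rfl⟩
      exact ⟨⟨MulOpposite.op (upper t : PSL(2, ℝ)), hu⟩ * a, mul_smul _ _ _⟩
  have huniv := hM.eq_univ hK hΓK (by
    convert hΓ using 1
    ext z
    constructor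
    · rintro ⟨γ, hγ, rfl⟩
      exact ⟨toPSL G γ, hγ, rfl⟩
    · rintro ⟨γ, hγ, rfl⟩
      obtain ⟨γ, rfl⟩ := surjective_toPSL γ
      exact ⟨γ, hγ, rfl⟩)
  intro z
  obtain ⟨h, rfl⟩ := hsurj z
  exact Set.eq_univ_iff_forall.1 huniv h

end Quotient

end Horocycle

theorem theorem1 {E : Type*} [NormedAddCommGroup E] [NormedSpace ℝ E] [FiniteDimensional ℝ E]
    {G : Type*} [Group G] [TopologicalSpace G] [ChartedSpace E G] [LieGroup 𝓘(ℝ, E) ∞ G]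
    [ConnectedSpace G] (Γ : Subgroup (PSL(2, ℝ) × G)) [DiscreteTopology Γ]
    [CompactSpace (Horocycle.X Γ)] :
    (MulAction.IsMinimal Horocycle.U.op (Horocycle.X Γ) ↔
      MulAction.IsMinimal PSL(2, ℝ)ᵐᵒᵖ (Horocycle.X Γ)) ∧
    (MulAction.IsMinimal PSL(2, ℝ)ᵐᵒᵖ (Horocycle.X Γ) ↔
      Dense (Γ.map (MonoidHom.snd PSL(2, ℝ) G) : Set G)) ∧
    (Subsingleton G → MulAction.IsMinimal Horocycle.U.op (Horocycle.X Γ)) := by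
  -- The Lie structure enters through these three topological facts; a T1 topological group is
  -- Hausdorff.
  have : IsTopologicalGroup G := topologicalGroup_of_lieGroup 𝓘(ℝ, E) ∞
  have : T1Space G := ChartedSpace.t1Space E G
  have : LocallyCompactSpace G := Manifold.locallyCompact_of_finiteDimensional 𝓘(ℝ, E)
  have hiff := Horocycle.isMinimal_iff_dense_map_snd Γ
  refine ⟨⟨fun h => ⟨fun x => (h.dense_orbit x).mono ?_⟩, fun h =>
    Horocycle.isMinimal_U_of_dense Γ (hiff.1 h)⟩, hiff, fun _ =>
    Horocycle.isMinimal_U_of_dense Γ fun g => subset_closure ?_⟩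
  · rintro _ ⟨a, rfl⟩
    exact ⟨a, rfl⟩
  · rw [Subsingleton.elim g 1]
    exact one_mem _
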